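/- Let $n\ge 0$ be an integer, $m=\lfloor n/2\rfloor$ and $k>0$. Let $X\cdot Y=\sum_{i=1}^n x_iy_i-ts$ be the Lorentz inner product of $X=(x_1,\dots,x_n,t)$ and $Y=(y_1,\dots,y_n,s)$ in $\mathbb R^{n,1}$, let $e_1,\dots,e_n,e_0=\partial/\partial t$ be the standard basis, and let $$\mathbb H^n_{-k^2}=\{X=(x_1,\dots,x_n,t)\in\mathbb R^{n,1} : X\cdot X=-1/k^2,\ t>0\}$$ with the induced metric $g'$. It is parametrized by the unit ball of $\mathbb R^n$ through $$X=\frac1k\Big(\frac{2x}{1-|x|^2},\frac{1+|x|^2}{1-|x|^2}\Big),\qquad |x|<1 .$$ Let $c(e_1),\dots,c(e_n)$ be the following Clifford matrices on $\mathbb C^{2^m}=\mathbb C^2\otimes\cdots\otimes\mathbb C^2$. With $$g_1=\begin{pmatrix}\sqrt{-1}&0\\0&-\sqrt{-1}\end{pmatrix},\quad g_2=\begin{pmatrix}0&\sqrt{-1}\\\sqrt{-1}&0\end{pmatrix},\quad T=\begin{pmatrix}0&-\sqrt{-1}\\\sqrt{-1}&0\end{pmatrix},$$ for $1\le j\le 2m$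 put $c(e_j)=I\otimes\cdots\otimes I\otimes g_{\alpha}\otimes T\otimes\cdots\otimes T$ with $\lfloor (j-1)/2\rfloor$ factors $T$, where $\alpha=1$ for odd $j$ and $\alpha=2$ for even $j$; if $n=2m+1$, put $c(e_{n})=\sqrt{-1}\,T\otimes\cdots\otimes T$. Put $c(e_0)=\sqrt{-1}\,I$ and $c(x)=\sum_{j=1}^n x_jc(e_j)$ for $x\in\mathbb R^n$. Trivialize the spinor bundle of $\mathbb H^n_{-k^2}$ by the global orthonormal frame $\bar e_i=\frac{k(1-|x|^2)}{2}\frac{\partial}{\partial x_i}$ in ball coordinates. Thus spinor fields are $\mathbb C^{2^m}$-valued functions, $|\cdot|_{g'}$ is the standard Hermitian norm, Clifford multiplication is $c'(\bar e_i)=c(e_i)$, and the spin connection is $$\nabla'_V\psi=V(\psi)+\tfrac12\sum_{j<l}g'(\nabla_V\bar e_j,\bar e_l)\,c(e_j)c(e_l)\psi,$$ where $\nabla$ is the Levi-Civita connection of $g'$. A Killing spinor is a smooth spinor field $\phi'$ with $\nabla'_V\phi'+\frac{\sqrt{-1}}{2}k\,c'(V)\phi'=0$ for every tangent vector $V$.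 For $a\in\mathbb C^{2^m}$ let $\phi'_{a,0}$ be the spinor field given in ball coordinates by $$\phi'_{a,0}(x)=\sqrt{\frac{2}{1-|x|^2}}\,\big(a-\sqrt{-1}\,c(x)a\big).$$ Then $\phi'_{a,0}$ is a Killing spinor, every Killing spinor on $\mathbb H^n_{-k^2}$ is $\phi'_{b,0}$ for a unique $b\in\mathbb C^{2^m}$, and at every point $X\in\mathbb H^n_{-k^2}$ $$|\phi'_{a,0}|_{g'}^2=-2k\,X\cdot\zeta_a,\qquad \zeta_a=\sum_{j=1}^n\langle\sqrt{-1}\,c(e_j)a,a\rangle e_j-\langle\sqrt{-1}\,c(e_0)a,a\rangle e_0\in\mathbb R^{n,1},$$ where $\langle\cdot,\cdot\rangle$ is the standard Hermitian inner product of $\mathbb C^{2^m}$. -/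

import Mathlib

open scoped ContDiff

noncomputable section

namespace HyperbolicSpinor

/-! ### Clifford matrices -/

/-- The matrix `g₁`. -/
def g₁ : Matrix (Fin 2) (Fin 2) ℂ := !![Complex.I, 0; 0, -Complex.I]

/-- The matrix `g₂`. -/
def g₂ : Matrix (Fin 2) (Fin 2) ℂ := !![0, Complex.I; Complex.I, 0]

/-- The matrix `T`. -/
def T : Matrix (Fin 2) (Fin 2) ℂ := !![0, -Complex.I; Complex.I, 0]

/-- The spinor module `ℂ^(2^m) = ℂ² ⊗ ⋯ ⊗ ℂ²` (`m = ⌊n/2⌋` factors) with its standard Hermitian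
inner product. Its standard basis is indexed by `{0,1}^m`; the factor with label `s` is the one
which has `s` factors to its right. -/
abbrev Spinor (n : ℕ) := EuclideanSpace ℂ (Fin (n / 2) → Fin 2)

/-- The factor with label `s` (counted from the right, from `0`) of the `j`-th Clifford matrix
(counted from `0`). -/
def cliffordFactor (j s : ℕ) : Matrix (Fin 2) (Fin 2) ℂ :=
  if s < j / 2 then T else if s = j / 2 then (if Even j then g₁ else g₂) else 1

/-- The Clifford matrices. With `j` counted from `0` and `m = ⌊n/2⌋`: for `j < 2m` it is
`1 ⊗ ⋯ ⊗ 1 ⊗ g ⊗ T ⊗ ⋯ ⊗ T` with `⌊j/2⌋` factors `T`, where `g = g₁` for even and `g = g₂` for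
odd `j`; for odd `n` and `j = 2m` it is `√-1 T ⊗ ⋯ ⊗ T`. -/
def cliffordMatrix (n : ℕ) (j : Fin n) :
    Matrix (Fin (n / 2) → Fin 2) (Fin (n / 2) → Fin 2) ℂ := fun p q =>
  (if (j : ℕ) = 2 * (n / 2) then Complex.I else 1) *
    ∏ s : Fin (n / 2), cliffordFactor j s (p s) (q s)

/-- `c(e_j)` acting on spinors. -/
def c {n : ℕ} (j : Fin n) : Spinor n →ₗ[ℂ] Spinor n :=
  Matrix.toEuclideanLin (cliffordMatrix n j)

/-- `c(v) = ∑ v_j c(e_j)` for `v ∈ ℝⁿ`. -/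
def cliff {n : ℕ} (v : EuclideanSpace ℝ (Fin n)) (s : Spinor n) : Spinor n :=
  ∑ j, (v j : ℂ) • c j s

/-! ### Minkowski space, the hyperboloid and its ball coordinates -/

/-- `ℝ^{n,1}`, with points `(x, t)`, `x ∈ ℝⁿ`, `t ∈ ℝ`. -/
abbrev Minkowski (n : ℕ) := EuclideanSpace ℝ (Fin n) × ℝ

/-- The Lorentz inner product `∑ xᵢ yᵢ - t s`. -/
def lorentz {n : ℕ} (P Q : Minkowski n) : ℝ := ∑ i, P.1 i * Q.1 i - P.2 * Q.2

/-- The hyperboloid model of the hyperbolic space of curvature `-k²`. -/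
def hyperboloid (n : ℕ) (k : ℝ) : Set (Minkowski n) :=
  {P | ∑ i, P.1 i ^ 2 - P.2 ^ 2 = -(1 / k ^ 2) ∧ 0 < P.2}

/-- The diffeomorphism from the unit ball (ball model) onto the hyperboloid. -/
def ofBall {n : ℕ} (k : ℝ) (x : EuclideanSpace ℝ (Fin n)) : Minkowski n :=
  ((1 / k * (2 / (1 - ‖x‖ ^ 2))) • x, 1 / k * ((1 + ‖x‖ ^ 2) / (1 - ‖x‖ ^ 2)))

/-- The inverse of `ofBall`: the coordinate of a point of the hyperboloid in the unit ball. -/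
def toBall {n : ℕ} (k : ℝ) (P : Minkowski n) : EuclideanSpace ℝ (Fin n) :=
  (k / (1 + k * P.2)) • P.1

/-! ### Riemannian geometry in one chart -/

/-- The coordinate vector `∂_i`. -/
abbrev coordVec {n : ℕ} (i : Fin n) : EuclideanSpace ℝ (Fin n) := EuclideanSpace.single i 1

/-- Partial derivative of a real function. -/
def partialD {n : ℕ} (i : Fin n) (f : EuclideanSpace ℝ (Fin n) → ℝ)
    (x : EuclideanSpace ℝ (Fin n)) : ℝ := fderiv ℝ f x (coordVec i)

/-- The inner product of two tangent vectors at `x` for a metric with coefficients `g i j`. -/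
def metricInner {n : ℕ} (g : EuclideanSpace ℝ (Fin n) → Matrix (Fin n) (Fin n) ℝ)
    (x V W : EuclideanSpace ℝ (Fin n)) : ℝ := ∑ i, ∑ j, g x i j * V i * W j

/-- The Christoffel symbol `Γ^l_{ij}` of a metric. -/
def christoffel {n : ℕ} (g : EuclideanSpace ℝ (Fin n) → Matrix (Fin n) (Fin n) ℝ)
    (x : EuclideanSpace ℝ (Fin n)) (l i j : Fin n) : ℝ :=
  1 / 2 * ∑ p, (g x)⁻¹ l p * (partialD i (fun y => g y j p) x + partialD j (fun y => g y i p) x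
    - partialD p (fun y => g y i j) x)

/-- The Levi-Civita covariant derivative `∇_V W` at `x` of a vector field `W`. -/
def leviCivita {n : ℕ} (g : EuclideanSpace ℝ (Fin n) → Matrix (Fin n) (Fin n) ℝ)
    (x V : EuclideanSpace ℝ (Fin n)) (W : EuclideanSpace ℝ (Fin n) → EuclideanSpace ℝ (Fin n)) :
    EuclideanSpace ℝ (Fin n) :=
  fderiv ℝ W x V + WithLp.toLp 2 (fun l => ∑ i, ∑ j, christoffel g x l i j * V i * W x j)

/-- The spin connection `∇_V ψ` at `x`, for a spinor field `ψ` written in the trivialization of the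
spinor bundle given by a global `g`-orthonormal frame `e`:
`∇_V ψ = V(ψ) + 1/2 ∑_{j<l} ⟨∇_V e_j, e_l⟩ c(e_j) c(e_l) ψ`. -/
def spinConnection {n : ℕ} (g : EuclideanSpace ℝ (Fin n) → Matrix (Fin n) (Fin n) ℝ)
    (e : Fin n → EuclideanSpace ℝ (Fin n) → EuclideanSpace ℝ (Fin n))
    (ψ : EuclideanSpace ℝ (Fin n) → Spinor n) (x V : EuclideanSpace ℝ (Fin n)) : Spinor n :=
  fderiv ℝ ψ x V + (1 / 2 : ℂ) • ∑ j, ∑ l with j < l,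
    ((metricInner g x (leviCivita g x V (e j)) (e l x) : ℝ) : ℂ) • c j (c l (ψ x))

/-- Clifford multiplication by a tangent vector `V` at `x` in the trivialization given by a
`g`-orthonormal frame `e`. -/
def cliffordMul {n : ℕ} (g : EuclideanSpace ℝ (Fin n) → Matrix (Fin n) (Fin n) ℝ)
    (e : Fin n → EuclideanSpace ℝ (Fin n) → EuclideanSpace ℝ (Fin n))
    (x V : EuclideanSpace ℝ (Fin n)) (s : Spinor n) : Spinor n :=
  ∑ j, ((metricInner g x V (e j x) : ℝ) : ℂ) • c j s

/-! ### Killing spinors on hyperbolic space -/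

/-- The hyperbolic metric in ball coordinates: the metric induced on the hyperboloid by the
Lorentz metric. -/
def hypMetric {n : ℕ} (k : ℝ) (x : EuclideanSpace ℝ (Fin n)) : Matrix (Fin n) (Fin n) ℝ :=
  fun i j => lorentz (fderiv ℝ (ofBall k) x (coordVec i)) (fderiv ℝ (ofBall k) x (coordVec j))

/-- The global orthonormal frame of the hyperbolic metric that is proportional to the coordinate
frame of the ball. -/
def hypFrame {n : ℕ} (k : ℝ) (i : Fin n) (x : EuclideanSpace ℝ (Fin n)) :
    EuclideanSpace ℝ (Fin n) := (k * (1 - ‖x‖ ^ 2) / 2) • coordVec i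

/-- A Killing spinor: a smooth spinor field `φ` with `∇_V φ + (√-1/2) k c(V) φ = 0` for all tangent
vectors `V`. The spinor bundle is trivialized by `hypFrame`, so that a spinor field is a
`Spinor n`-valued function on the hyperboloid and its pointwise norm is the Hermitian norm. The
function `φ` is evaluated only on the hyperboloid. -/
def IsKillingSpinor {n : ℕ} (k : ℝ) (φ : Minkowski n → Spinor n) : Prop :=
  ContDiffOn ℝ ∞ (fun x => φ (ofBall k x)) (Metric.ball 0 1) ∧
  ∀ x ∈ Metric.ball (0 : EuclideanSpace ℝ (Fin n)) 1, ∀ V : EuclideanSpace ℝ (Fin n),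
    spinConnection (hypMetric k) (hypFrame k) (fun y => φ (ofBall k y)) x V
      + (Complex.I / 2 * (k : ℂ)) • cliffordMul (hypMetric k) (hypFrame k) x V (φ (ofBall k x)) = 0

/-- The spinor field `φ_a` corresponding to `a`, given in the ball coordinate `x` by
`√(2 / (1 - |x|²)) (a - √-1 c(x) a)`. -/
def killingSpinor {n : ℕ} (k : ℝ) (a : Spinor n) (P : Minkowski n) : Spinor n :=
  ((√(2 / (1 - ‖toBall k P‖ ^ 2)) : ℝ) : ℂ) • (a - Complex.I • cliff (toBall k P) a)

/-- `ζ_a = ∑_j ⟨√-1 c(e_j) a, a⟩ e_j - ⟨√-1 c(e_0) a, a⟩ e_0` with `c(e_0) = √-1`. These numbers are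
real, see `zeta_fst` and `zeta_snd`. -/
def zeta {n : ℕ} (a : Spinor n) : Minkowski n :=
  (WithLp.toLp 2 (fun j => (inner ℂ a (Complex.I • c j a)).re),
    -(inner ℂ a (Complex.I • (Complex.I • a))).re)

theorem cliffordMatrix_conjTranspose (n : ℕ) (j : Fin n) :
    (cliffordMatrix n j).conjTranspose = -cliffordMatrix n j := by
  have hT : ∀ x y, star (T y x) = T x y := by
    intro x y; fin_cases x <;> fin_cases y <;> simp [T]
  have h1 : ∀ x y, star (g₁ y x) = -g₁ x y := by
    intro x y; fin_cases x <;> fin_cases y <;> simp [g₁]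
  have h2 : ∀ x y, star (g₂ y x) = -g₂ x y := by
    intro x y; fin_cases x <;> fin_cases y <;> simp [g₂]
  have h0 : ∀ x y, star ((1 : Matrix (Fin 2) (Fin 2) ℂ) y x) = (1 : Matrix (Fin 2) (Fin 2) ℂ) x y := by
    intro x y; fin_cases x <;> fin_cases y <;> simp
  have hF : ∀ s x y, star (cliffordFactor j s y x) =
      (if s = (j : ℕ) / 2 then -1 else 1) * cliffordFactor j s x y := by
    intro s x y
    unfold cliffordFactor
    split_ifs <;> first | omega | simp only [hT, h1, h2, h0, one_mul, neg_mul]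
  ext p q
  simp only [Matrix.conjTranspose_apply, Matrix.neg_apply, cliffordMatrix, star_mul', star_prod, hF,
    Finset.prod_mul_distrib]
  have hj := j.2
  by_cases h : (j : ℕ) = 2 * (n / 2)
  · have h' : ∀ s : Fin (n / 2), ¬ ((s : ℕ) = (j : ℕ) / 2) := fun s => by
      have := s.2
      omega
    simp only [h', if_false, Finset.prod_const_one, one_mul]
    simp [h]
  · have h' : ∀ s : Fin (n / 2), ((s : ℕ) = (j : ℕ) / 2) ↔ s = ⟨(j : ℕ) / 2, by omega⟩ :=
      fun s => by rw [Fin.ext_iff]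
    simp only [h', Finset.prod_ite_eq', Finset.mem_univ, if_true]
    simp [h]

theorem zeta_fst {n : ℕ} (a : Spinor n) (j : Fin n) :
    (((zeta a).1 j : ℝ) : ℂ) = inner ℂ a (Complex.I • c j a) := by
  have h : inner ℂ (c j a) a = -inner ℂ a (c j a) := by
    rw [c, ← LinearMap.adjoint_inner_right, ← Matrix.toEuclideanLin_conjTranspose_eq_adjoint,
      cliffordMatrix_conjTranspose, map_neg, LinearMap.neg_apply, inner_neg_right]
  refine Complex.conj_eq_iff_re.mp ?_
  rw [inner_conj_symm, inner_smul_left, inner_smul_right, h]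
  simp

theorem zeta_snd {n : ℕ} (a : Spinor n) :
    (((zeta a).2 : ℝ) : ℂ) = -inner ℂ a (Complex.I • (Complex.I • a)) := by
  have h : inner ℂ a (Complex.I • (Complex.I • a)) = ((-‖a‖ ^ 2 : ℝ) : ℂ) := by
    rw [smul_smul, Complex.I_mul_I, neg_one_smul, inner_neg_right, inner_self_eq_norm_sq_to_K]
    simp
  simp only [zeta]
  rw [h, Complex.ofReal_neg, Complex.ofReal_re]

end HyperbolicSpinor

end

/-! In the ball the induced metric is conformally flat, with factor `(2 / k / (1 - |x|²))²`. In the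
frame `hypFrame` its connection form in direction `V` has the coefficients of `x ∧ V`, up to the
factor `2 / (1 - |x|²)`. The Clifford relations turn this into `c(x) c(V) + ⟨x, V⟩`, so the Killing
equation becomes the linear system of `isKillingSpinor_iff`: `dψ(V) = -(c(x) c(V) ψ + ⟨x, V⟩ ψ + √-1
c(V) ψ) / (1 - |x|²)`.

Put `f = √(2 / (1 - |x|²))`, so that `df(V) = f ⟨x, V⟩ / (1 - |x|²)`. Substitution shows that `f (1
- √-1 c(x)) a` solves the system. Conversely, `f (1 + √-1 c(x)) ψ` has zero derivative for every
solution `ψ`, hence is constant on the ball (`IsKillingSpinor.exists_const`). Since `c(x)² = -|x|²`,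
the operators `f (1 ± √-1 c(x))` have product `2`; this recovers `ψ` from the constant. The value at
`x = 0` gives uniqueness.

For the length, `c(x)` is skew-Hermitian with square `-|x|²`, so `|a - √-1 c(x) a|² = (1 + |x|²)|a|²
- 2 Re ⟨a, √-1 c(x) a⟩`. The two terms are the time and space parts of the pairing with `ζ_a`. -/

noncomputable section

namespace HyperbolicSpinor

/-! ### The Clifford relations -/

/-- The tensor product of a family of `2 × 2` matrices. -/
def tensorMatrix {m : ℕ} (F : Fin m → Matrix (Fin 2) (Fin 2) ℂ) :
    Matrix (Fin m → Fin 2) (Fin m → Fin 2) ℂ := fun p q => ∏ s, F s (p s) (q s)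

/-- Distributivity: a product over the slots of sums over `Fin 2` is a sum over all functions from
slots to `Fin 2`, that is, over the intermediate index of the matrix product. -/
theorem tensorMatrix_mul {m : ℕ} (F G : Fin m → Matrix (Fin 2) (Fin 2) ℂ) :
    tensorMatrix F * tensorMatrix G = tensorMatrix (fun s => F s * G s) := by
  ext p q
  simp only [Matrix.mul_apply, tensorMatrix, ← Finset.prod_mul_distrib]
  rw [Finset.prod_univ_sum, Fintype.piFinset_univ]

theorem tensorMatrix_smul {m : ℕ} (ε : Fin m → ℂ) (F : Fin m → Matrix (Fin 2) (Fin 2) ℂ) :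
    tensorMatrix (fun s => ε s • F s) = (∏ s, ε s) • tensorMatrix F := by
  ext p q
  simp [tensorMatrix, Finset.prod_mul_distrib]

theorem tensorMatrix_one {m : ℕ} :
    tensorMatrix (fun _ : Fin m => (1 : Matrix (Fin 2) (Fin 2) ℂ)) = 1 := by
  ext p q
  by_cases h : p = q
  · subst h; simp [tensorMatrix]
  · obtain ⟨s, hs⟩ := Function.ne_iff.mp h
    rw [Matrix.one_apply_ne h]
    exact Finset.prod_eq_zero (Finset.mem_univ s) (Matrix.one_apply_ne hs)

theorem cliffordMatrix_eq {n : ℕ} (j : Fin n) :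
    cliffordMatrix n j = (if (j : ℕ) = 2 * (n / 2) then Complex.I else 1) •
      tensorMatrix (fun s : Fin (n / 2) => cliffordFactor j s) := rfl

theorem T_mul_T : T * T = 1 := by
  ext i j; fin_cases i <;> fin_cases j <;> simp [T]

theorem g₁_mul_g₁ : g₁ * g₁ = -1 := by
  ext i j; fin_cases i <;> fin_cases j <;> simp [g₁]

theorem g₂_mul_g₂ : g₂ * g₂ = -1 := by
  ext i j; fin_cases i <;> fin_cases j <;> simp [g₂]

theorem g₁_mul_T : g₁ * T = -(T * g₁) := by
  ext i j; fin_cases i <;> fin_cases j <;> simp [g₁, T]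

theorem g₂_mul_T : g₂ * T = -(T * g₂) := by
  ext i j; fin_cases i <;> fin_cases j <;> simp [g₂, T]

theorem g₁_mul_g₂ : g₁ * g₂ = -(g₂ * g₁) := by
  ext i j; fin_cases i <;> fin_cases j <;> simp [g₁, g₂]

theorem cliffordFactor_mul_self (j s : ℕ) :
    cliffordFactor j s * cliffordFactor j s = (if s = j / 2 then (-1 : ℂ) else 1) • 1 := by
  unfold cliffordFactor
  split_ifs <;> first | omega | simp [T_mul_T, g₁_mul_g₁, g₂_mul_g₂]

/-- Only the slot `i / 2` contributes a sign: there a `g` meets `T`, or `g₁` meets `g₂` when `i / 2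
= j / 2`. To its right both factors are `T`; to its left the factor of `i` is `1`. -/
theorem cliffordFactor_mul_comm {i j : ℕ} (h : i < j) (s : ℕ) :
    cliffordFactor i s * cliffordFactor j s =
      (if s = i / 2 then (-1 : ℂ) else 1) • (cliffordFactor j s * cliffordFactor i s) := by
  unfold cliffordFactor
  simp only [Nat.even_iff]
  split_ifs <;> first | omega | simp [g₁_mul_T, g₂_mul_T, g₁_mul_g₂]

theorem prod_sign {m r : ℕ} (h : r < m) :
    ∏ s : Fin m, (if (s : ℕ) = r then (-1 : ℂ) else 1) = -1 := by
  have h' : ∀ s : Fin m, ((s : ℕ) = r) ↔ s = ⟨r, h⟩ := fun s => by rw [Fin.ext_iff]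
  simp only [h', Finset.prod_ite_eq', Finset.mem_univ, if_true]

theorem cliffordMatrix_mul_self {n : ℕ} (j : Fin n) :
    cliffordMatrix n j * cliffordMatrix n j = -1 := by
  have hj := j.2
  rw [cliffordMatrix_eq, Matrix.smul_mul, Matrix.mul_smul, tensorMatrix_mul, smul_smul]
  simp only [cliffordFactor_mul_self]
  rw [tensorMatrix_smul (fun s : Fin (n / 2) => if (s : ℕ) = (j : ℕ) / 2 then (-1 : ℂ) else 1),
    tensorMatrix_one]
  -- For the extra matrix of odd `n` no slot carries a `g`, so the tensor part squares to `1` and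
  -- the sign comes from the prefactor `√-1`.
  by_cases h : (j : ℕ) = 2 * (n / 2)
  · have h' : ∀ s : Fin (n / 2), ¬ ((s : ℕ) = (j : ℕ) / 2) := fun s => by
      have := s.2
      omega
    simp only [h', if_false, Finset.prod_const_one]
    simp [h]
  · rw [prod_sign (by omega)]
    simp [h]

theorem cliffordMatrix_mul_comm_of_lt {n : ℕ} {i j : Fin n} (h : i < j) :
    cliffordMatrix n i * cliffordMatrix n j = -(cliffordMatrix n j * cliffordMatrix n i) := by
  have hj := j.2
  have hij : (i : ℕ) < j := h
  simp only [cliffordMatrix_eq, Matrix.smul_mul, Matrix.mul_smul, tensorMatrix_mul, smul_smul,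
    cliffordFactor_mul_comm hij]
  -- As `i < j < n`, the slot `i / 2` exists even when `j` is the extra matrix of odd `n`.
  rw [tensorMatrix_smul (fun s : Fin (n / 2) => if (s : ℕ) = (i : ℕ) / 2 then (-1 : ℂ) else 1),
    prod_sign (by omega), neg_one_smul, smul_neg, mul_comm]

theorem c_c {n : ℕ} (i j : Fin n) (s : Spinor n) :
    c i (c j s) = Matrix.toEuclideanLin (cliffordMatrix n i * cliffordMatrix n j) s := by
  simp [c, Matrix.toLpLin_apply, Matrix.mulVec_mulVec]

theorem c_c_self {n : ℕ} (j : Fin n) (s : Spinor n) : c j (c j s) = -s := by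
  rw [c_c, cliffordMatrix_mul_self, map_neg]
  simp

theorem c_c_comm_of_ne {n : ℕ} {i j : Fin n} (h : i ≠ j) (s : Spinor n) :
    c i (c j s) = -c j (c i s) := by
  rcases lt_or_gt_of_ne h with h | h
  · rw [c_c, c_c, cliffordMatrix_mul_comm_of_lt h, map_neg]; rfl
  · rw [c_c, c_c, cliffordMatrix_mul_comm_of_lt h, map_neg]; simp

theorem inner_c_left {n : ℕ} (j : Fin n) (s t : Spinor n) :
    inner ℂ (c j s) t = -inner ℂ s (c j t) := by
  rw [c, ← LinearMap.adjoint_inner_right, ← Matrix.toEuclideanLin_conjTranspose_eq_adjoint,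
    cliffordMatrix_conjTranspose, map_neg, LinearMap.neg_apply, inner_neg_right]

/-! ### Clifford multiplication by vectors -/

/-- Clifford multiplication as a continuous bilinear map. -/
def cliffL (n : ℕ) : EuclideanSpace ℝ (Fin n) →L[ℝ] Spinor n →L[ℝ] Spinor n :=
  ∑ j, (EuclideanSpace.proj j : EuclideanSpace ℝ (Fin n) →L[ℝ] ℝ).smulRight
    (LinearMap.toContinuousLinearMap ((c j).restrictScalars ℝ))

theorem cliffL_apply {n : ℕ} (v : EuclideanSpace ℝ (Fin n)) (s : Spinor n) :
    cliffL n v s = cliff v s := by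
  simp [cliffL, cliff]

theorem cliff_smul_right {n : ℕ} (v : EuclideanSpace ℝ (Fin n)) (z : ℂ) (s : Spinor n) :
    cliff v (z • s) = z • cliff v s := by
  simp [cliff, Finset.smul_sum, smul_comm z]

theorem cliff_add_right {n : ℕ} (v : EuclideanSpace ℝ (Fin n)) (s t : Spinor n) :
    cliff v (s + t) = cliff v s + cliff v t := by
  simp only [← cliffL_apply, map_add]

theorem cliff_sub_right {n : ℕ} (v : EuclideanSpace ℝ (Fin n)) (s t : Spinor n) :
    cliff v (s - t) = cliff v s - cliff v t := by
  simp only [← cliffL_apply, map_sub]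

theorem cliff_neg_right {n : ℕ} (v : EuclideanSpace ℝ (Fin n)) (s : Spinor n) :
    cliff v (-s) = -cliff v s := by
  simp only [← cliffL_apply, map_neg]

theorem cliff_cliff_eq_sum {n : ℕ} (v w : EuclideanSpace ℝ (Fin n)) (s : Spinor n) :
    cliff v (cliff w s) = ∑ i, ∑ j, ((v i : ℂ) * (w j : ℂ)) • c i (c j s) := by
  simp only [cliff, map_sum, map_smul, Finset.smul_sum, smul_smul]

theorem inner_eq_sum {n : ℕ} (v w : EuclideanSpace ℝ (Fin n)) :
    inner ℝ v w = ∑ i, v i * w i := by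
  simp [PiLp.inner_apply, mul_comm]

theorem sum_sum_lt {ι M : Type*} [Fintype ι] [LinearOrder ι] [AddCommMonoid M] (f : ι → ι → M) :
    ∑ i, ∑ j, f i j = (∑ i, ∑ j with i < j, (f i j + f j i)) + ∑ i, f i i := by
  have h : ∀ i, ∑ j, f i j = (∑ j with i < j, f i j) + (∑ j with j < i, f i j) + f i i := by
    intro i
    have h' : ∀ j, f i j = (if i < j then f i j else 0) + (if j < i then f i j else 0)
        + (if i = j then f i j else 0) := by
      intro j
      rcases lt_trichotomy i j with h | h | h
      · simp [h, h.not_gt, h.ne]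
      · simp [h]
      · simp [h, h.not_gt, h.ne']
    rw [Finset.sum_congr rfl fun j _ => h' j]
    simp [Finset.sum_add_distrib, Finset.sum_filter]
  simp only [h, Finset.sum_add_distrib]
  congr 2
  simp only [Finset.sum_filter]
  rw [Finset.sum_comm]

/-- Pairs `i < j` are antisymmetrized by anticommutation, and the diagonal gives the inner product.
The sum over `i < j` has the shape of the spin connection term, so this evaluates that term in
closed form. -/
theorem cliff_cliff_eq_sum_lt {n : ℕ} (v w : EuclideanSpace ℝ (Fin n)) (s : Spinor n) :
    cliff v (cliff w s) =
      (∑ i, ∑ j with i < j, ((v i * w j - w i * v j : ℝ) : ℂ) • c i (c j s))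
        - ((inner ℝ v w : ℝ) : ℂ) • s := by
  rw [cliff_cliff_eq_sum, sum_sum_lt, sub_eq_add_neg]
  congr 1
  · refine Finset.sum_congr rfl fun i _ => Finset.sum_congr rfl fun j hj => ?_
    rw [c_c_comm_of_ne (ne_of_gt (Finset.mem_filter.mp hj).2)]
    push_cast
    module
  · simp only [c_c_self, inner_eq_sum]
    push_cast
    rw [Finset.sum_smul, ← Finset.sum_neg_distrib]
    simp

theorem cliff_cliff_comm {n : ℕ} (v w : EuclideanSpace ℝ (Fin n)) (s : Spinor n) :
    cliff v (cliff w s) = -cliff w (cliff v s) - (2 * ((inner ℝ v w : ℝ) : ℂ)) • s := by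
  rw [cliff_cliff_eq_sum_lt v w, cliff_cliff_eq_sum_lt w v, real_inner_comm w v]
  have : ∀ i j, ((w i * v j - v i * w j : ℝ) : ℂ) = -((v i * w j - w i * v j : ℝ) : ℂ) := by
    intros; push_cast; ring
  simp only [this, neg_smul, Finset.sum_neg_distrib]
  module

theorem cliff_cliff_self {n : ℕ} (v : EuclideanSpace ℝ (Fin n)) (s : Spinor n) :
    cliff v (cliff v s) = -(((‖v‖ ^ 2 : ℝ) : ℂ) • s) := by
  rw [cliff_cliff_eq_sum_lt, real_inner_self_eq_norm_sq]
  simp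

theorem inner_cliff_left {n : ℕ} (v : EuclideanSpace ℝ (Fin n)) (s t : Spinor n) :
    inner ℂ (cliff v s) t = -inner ℂ s (cliff v t) := by
  simp only [cliff, sum_inner, inner_sum, inner_smul_left, inner_smul_right, inner_c_left,
    Complex.conj_ofReal, mul_neg, Finset.sum_neg_distrib]

/-! ### Ball coordinates -/

theorem one_sub_norm_sq_pos {E : Type*} [SeminormedAddCommGroup E] {x : E}
    (hx : x ∈ Metric.ball (0 : E) 1) : 0 < 1 - ‖x‖ ^ 2 := by
  have h : ‖x‖ < 1 := by simpa using hx
  nlinarith [norm_nonneg x]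

theorem toBall_ofBall {n : ℕ} {k : ℝ} (hk : 0 < k) {x : EuclideanSpace ℝ (Fin n)}
    (hx : x ∈ Metric.ball (0 : EuclideanSpace ℝ (Fin n)) 1) : toBall k (ofBall k x) = x := by
  have h := one_sub_norm_sq_pos hx
  have e : 1 + k * (1 / k * ((1 + ‖x‖ ^ 2) / (1 - ‖x‖ ^ 2))) = 2 / (1 - ‖x‖ ^ 2) := by
    field_simp; ring
  simp only [toBall, ofBall, smul_smul, e]
  have : k / (2 / (1 - ‖x‖ ^ 2)) * (1 / k * (2 / (1 - ‖x‖ ^ 2))) = 1 := by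
    field_simp
  rw [this, one_smul]

/-- On the hyperboloid `k² |P.1|² = (k t - 1)(k t + 1)` with `t = P.2`, and one factor cancels. -/
theorem norm_toBall_sq {n : ℕ} {k : ℝ} (hk : 0 < k) {P : Minkowski n}
    (hP : P ∈ hyperboloid n k) : ‖toBall k P‖ ^ 2 = (k * P.2 - 1) / (k * P.2 + 1) := by
  obtain ⟨h1, h2⟩ := hP
  have h0 : 0 < 1 + k * P.2 := by positivity
  have hn : ‖P.1‖ ^ 2 = P.2 ^ 2 - 1 / k ^ 2 := by
    rw [EuclideanSpace.real_norm_sq_eq]; linarith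
  rw [toBall, norm_smul, mul_pow, Real.norm_eq_abs, sq_abs, hn]
  field_simp
  ring

theorem toBall_mem_ball {n : ℕ} {k : ℝ} (hk : 0 < k) {P : Minkowski n}
    (hP : P ∈ hyperboloid n k) : toBall k P ∈ Metric.ball (0 : EuclideanSpace ℝ (Fin n)) 1 := by
  have h2 := hP.2
  have h0 : 0 < k * P.2 + 1 := by positivity
  have : ‖toBall k P‖ ^ 2 < 1 := by
    rw [norm_toBall_sq hk hP, div_lt_one h0]; linarith
  rw [mem_ball_zero_iff]
  exact lt_of_pow_lt_pow_left₀ 2 zero_le_one (by simpa using this)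

theorem ofBall_toBall {n : ℕ} {k : ℝ} (hk : 0 < k) {P : Minkowski n}
    (hP : P ∈ hyperboloid n k) : ofBall k (toBall k P) = P := by
  have h2 := hP.2
  have h0 : 0 < k * P.2 + 1 := by positivity
  have e : 1 - (k * P.2 - 1) / (k * P.2 + 1) = 2 / (k * P.2 + 1) := by
    field_simp; ring
  simp only [ofBall, norm_toBall_sq hk hP, e]
  refine Prod.ext ?_ ?_
  · simp only [toBall, smul_smul]
    have : 1 / k * (2 / (2 / (k * P.2 + 1))) * (k / (1 + k * P.2)) = 1 := by
      field_simp; ring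
    rw [this, one_smul]
  · simp only
    field_simp; ring

theorem ofBall_zero_mem_hyperboloid {n : ℕ} {k : ℝ} (hk : 0 < k) :
    ofBall k (0 : EuclideanSpace ℝ (Fin n)) ∈ hyperboloid n k := by
  simp [ofBall, hyperboloid, hk]

/-! ### The hyperbolic metric -/

theorem hasFDerivAt_one_sub_norm_sq {E : Type*} [NormedAddCommGroup E] [InnerProductSpace ℝ E]
    (x : E) : HasFDerivAt (fun y : E => 1 - ‖y‖ ^ 2) (-((2 : ℝ) • innerSL ℝ x)) x := by
  refine (((hasStrictFDerivAt_norm_sq x).hasFDerivAt).const_sub (1 : ℝ)).congr_fderiv ?_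
  ext v
  simp [two_smul]

theorem hasFDerivAt_const_div_one_sub_norm_sq {E : Type*} [NormedAddCommGroup E]
    [InnerProductSpace ℝ E] (b : ℝ) {x : E} (hx : 1 - ‖x‖ ^ 2 ≠ 0) :
    HasFDerivAt (fun y : E => b / (1 - ‖y‖ ^ 2))
      ((2 * b / (1 - ‖x‖ ^ 2) ^ 2) • innerSL ℝ x) x := by
  refine (((hasDerivAt_inv hx).comp_hasFDerivAt x (hasFDerivAt_one_sub_norm_sq x)).const_mul
    b).congr_fderiv ?_
  ext v
  simp only [smul_apply, smul_eq_mul, neg_apply, innerSL_apply_apply]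
  field_simp

theorem eventually_one_sub_norm_sq_ne {E : Type*} [NormedAddCommGroup E] {x : E}
    (hx : 1 - ‖x‖ ^ 2 ≠ 0) : ∀ᶠ y in nhds x, 1 - ‖y‖ ^ 2 ≠ 0 :=
  ContinuousAt.eventually_ne (by fun_prop) hx

theorem fderiv_ofBall {n : ℕ} (k : ℝ) {x : EuclideanSpace ℝ (Fin n)} (hx : 1 - ‖x‖ ^ 2 ≠ 0)
    (V : EuclideanSpace ℝ (Fin n)) : fderiv ℝ (ofBall k) x V =
      ((4 / k / (1 - ‖x‖ ^ 2) ^ 2 * inner ℝ x V) • x + (2 / k / (1 - ‖x‖ ^ 2)) • V,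
        4 / k / (1 - ‖x‖ ^ 2) ^ 2 * inner ℝ x V) := by
  have h := hasFDerivAt_const_div_one_sub_norm_sq (2 / k) hx
  have h' := (h.fun_smul (hasFDerivAt_id x)).prodMk (h.sub_const (1 / k))
  -- Because `(1 + r) / (1 - r) = 2 / (1 - r) - 1`, both components are governed by the single
  -- function `2 / k / (1 - |y|²)`.
  have e : ofBall k =ᶠ[nhds x] fun y => ((2 / k / (1 - ‖y‖ ^ 2)) • id y,
      2 / k / (1 - ‖y‖ ^ 2) - 1 / k) := by
    filter_upwards [eventually_one_sub_norm_sq_ne hx] with y hy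
    refine Prod.ext ?_ ?_
    · simp only [ofBall, id]
      congr 1
      ring
    · simp only [ofBall]
      rcases eq_or_ne k 0 with rfl | hk
      · simp
      · field_simp; ring
  rw [(h'.congr_of_eventuallyEq e).fderiv]
  refine Prod.ext ?_ ?_
  · simp only [ContinuousLinearMap.prod_apply, add_apply,
      smul_apply, ContinuousLinearMap.smulRight_apply,
      ContinuousLinearMap.id_apply, innerSL_apply_apply, smul_eq_mul, id]
    module
  · simp only [ContinuousLinearMap.prod_apply, smul_apply,
      innerSL_apply_apply, smul_eq_mul]
    ring

theorem lorentz_eq {n : ℕ} (P Q : Minkowski n) : lorentz P Q = inner ℝ P.1 Q.1 - P.2 * Q.2 := by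
  rw [lorentz, inner_eq_sum]

/-- The `x_i x_j` terms cancel: the time component and the radial part together give `-(1 - |x|²)`
times a product of height derivatives, which the two cross terms compensate. -/
theorem hypMetric_eq {n : ℕ} (k : ℝ) {x : EuclideanSpace ℝ (Fin n)} (hx : 1 - ‖x‖ ^ 2 ≠ 0) :
    hypMetric k x = ((2 / k / (1 - ‖x‖ ^ 2)) ^ 2) • (1 : Matrix (Fin n) (Fin n) ℝ) := by
  ext i j
  have hij : inner ℝ (coordVec i : EuclideanSpace ℝ (Fin n)) (coordVec j)
      = (1 : Matrix (Fin n) (Fin n) ℝ) i j := by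
    simp [Matrix.one_apply, EuclideanSpace.inner_single_left]
  rw [hypMetric, fderiv_ofBall k hx, fderiv_ofBall k hx, lorentz_eq]
  simp only [inner_add_left, inner_add_right, real_inner_smul_left, real_inner_smul_right,
    real_inner_self_eq_norm_sq, hij, Matrix.smul_apply, smul_eq_mul,
    real_inner_comm x (coordVec i)]
  generalize inner ℝ x (coordVec i) = a
  generalize inner ℝ x (coordVec j) = b
  generalize (1 : Matrix (Fin n) (Fin n) ℝ) i j = d
  rcases eq_or_ne k 0 with rfl | hk
  · simp
  · field_simp
    ring

theorem metricInner_hypMetric {n : ℕ} (k : ℝ) {x : EuclideanSpace ℝ (Fin n)}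
    (hx : 1 - ‖x‖ ^ 2 ≠ 0) (V W : EuclideanSpace ℝ (Fin n)) :
    metricInner (hypMetric k) x V W = (2 / k / (1 - ‖x‖ ^ 2)) ^ 2 * inner ℝ V W := by
  simp [metricInner, hypMetric_eq k hx, inner_eq_sum, Matrix.one_apply, Finset.mul_sum, mul_assoc]

theorem inner_coordVec {n : ℕ} (x : EuclideanSpace ℝ (Fin n)) (i : Fin n) :
    inner ℝ x (coordVec i) = x i := by
  simp [EuclideanSpace.inner_single_right]

theorem partialD_hypMetric {n : ℕ} (k : ℝ) {x : EuclideanSpace ℝ (Fin n)}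
    (hx : 1 - ‖x‖ ^ 2 ≠ 0) (p i j : Fin n) :
    partialD p (fun y => hypMetric k y i j) x =
      (2 / k / (1 - ‖x‖ ^ 2)) ^ 2 * (4 / (1 - ‖x‖ ^ 2)) * x p *
        (1 : Matrix (Fin n) (Fin n) ℝ) i j := by
  have e : (fun y => hypMetric k y i j) =ᶠ[nhds x]
      fun y => (2 / k / (1 - ‖y‖ ^ 2)) ^ 2 * (1 : Matrix (Fin n) (Fin n) ℝ) i j := by
    filter_upwards [eventually_one_sub_norm_sq_ne hx] with y hy
    rw [hypMetric_eq k hy]; rfl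
  have h := ((hasDerivAt_pow 2 _).comp_hasFDerivAt x
    (hasFDerivAt_const_div_one_sub_norm_sq (2 / k) hx)).mul_const
    ((1 : Matrix (Fin n) (Fin n) ℝ) i j)
  rw [partialD, (h.congr_of_eventuallyEq e).fderiv]
  simp only [smul_apply, innerSL_apply_apply, smul_eq_mul, inner_coordVec]
  push_cast
  generalize (1 : Matrix (Fin n) (Fin n) ℝ) i j = d
  field_simp
  ring

/-- This is the formula for a conformal metric `exp(2u) δ`, with `∂_p u = 2 x_p / (1 - |x|²)`. -/
theorem christoffel_hypMetric {n : ℕ} {k : ℝ} (hk : 0 < k) {x : EuclideanSpace ℝ (Fin n)}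
    (hx : 1 - ‖x‖ ^ 2 ≠ 0) (l i j : Fin n) :
    christoffel (hypMetric k) x l i j = 2 / (1 - ‖x‖ ^ 2) *
      (x i * (1 : Matrix (Fin n) (Fin n) ℝ) j l + x j * (1 : Matrix (Fin n) (Fin n) ℝ) i l
        - x l * (1 : Matrix (Fin n) (Fin n) ℝ) i j) := by
  have hc : (2 / k / (1 - ‖x‖ ^ 2)) ^ 2 ≠ 0 := by
    have := hk.ne'
    positivity
  have hinv : (hypMetric k x)⁻¹ =
      ((2 / k / (1 - ‖x‖ ^ 2)) ^ 2)⁻¹ • (1 : Matrix (Fin n) (Fin n) ℝ) := by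
    rw [hypMetric_eq k hx]
    refine Matrix.inv_eq_left_inv ?_
    rw [Matrix.smul_mul, Matrix.mul_smul, smul_smul, inv_mul_cancel₀ hc, one_smul, one_mul]
  have hl : ∀ f : Fin n → ℝ, ∑ p, (1 : Matrix (Fin n) (Fin n) ℝ) l p * f p = f l := by
    intro f; simp [Matrix.one_apply]
  simp only [christoffel, hinv, partialD_hypMetric k hx, Matrix.smul_apply, smul_eq_mul, mul_assoc,
    ← Finset.mul_sum, hl]
  generalize (2 / k / (1 - ‖x‖ ^ 2)) ^ 2 = C at hc
  field_simp
  ring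

/-- Differentiating the scale factor of the frame gives `-k ⟨x, V⟩ ∂_j`, which cancels the radial
Christoffel term; an infinitesimal rotation in the plane of `x` and `V` remains. -/
theorem leviCivita_hypFrame {n : ℕ} {k : ℝ} (hk : 0 < k) {x : EuclideanSpace ℝ (Fin n)}
    (hx : 1 - ‖x‖ ^ 2 ≠ 0) (V : EuclideanSpace ℝ (Fin n)) (j : Fin n) :
    leviCivita (hypMetric k) x V (hypFrame k j) = k • (x j • V - V j • x) := by
  have hW : HasFDerivAt (hypFrame k j)
      (((-k) • innerSL ℝ x).smulRight (coordVec j)) x := by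
    have := ((hasFDerivAt_one_sub_norm_sq x).const_mul (k / 2)).smul_const
      (coordVec j : EuclideanSpace ℝ (Fin n))
    refine (this.congr_fderiv ?_).congr_of_eventuallyEq (Filter.Eventually.of_forall fun y => ?_)
    · ext v
      simp only [smul_apply, neg_apply,
        ContinuousLinearMap.smulRight_apply, innerSL_apply_apply, smul_eq_mul, PiLp.smul_apply]
      ring
    · simp only [hypFrame]; congr 1; ring
  rw [leviCivita, hW.fderiv]
  ext l
  have hd : (coordVec j : EuclideanSpace ℝ (Fin n)) l = (1 : Matrix (Fin n) (Fin n) ℝ) j l := by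
    simp [Matrix.one_apply, eq_comm]
  have hs : ∑ i, ∑ p, christoffel (hypMetric k) x l i p * V i * hypFrame k j x p
      = k * (inner ℝ x V * (1 : Matrix (Fin n) (Fin n) ℝ) j l + x j * V l - x l * V j) := by
    have h1 : ∀ i, ∑ p, christoffel (hypMetric k) x l i p * V i * hypFrame k j x p
        = k * (x i * V i * (1 : Matrix (Fin n) (Fin n) ℝ) j l
          + x j * (V i * (1 : Matrix (Fin n) (Fin n) ℝ) i l)
          - x l * (V i * (1 : Matrix (Fin n) (Fin n) ℝ) i j)) := by
      intro i
      rw [Finset.sum_eq_single j]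
      · rw [christoffel_hypMetric hk hx]
        simp only [hypFrame, PiLp.smul_apply, PiLp.single_apply, if_true, smul_eq_mul]
        field_simp
      · intro p _ hp
        simp [hypFrame, hp]
      · simp
    simp only [h1, ← Finset.mul_sum, Finset.sum_sub_distrib, Finset.sum_add_distrib,
      ← Finset.sum_mul, inner_eq_sum]
    simp [Matrix.one_apply]
  simp only [PiLp.add_apply, PiLp.sub_apply, PiLp.smul_apply, hs, hd,
    smul_apply, ContinuousLinearMap.smulRight_apply, innerSL_apply_apply,
    smul_eq_mul]
  ring

/-! ### Spin connection, Clifford multiplication and the Killing equation in the conformal frame. -/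

theorem metricInner_leviCivita_hypFrame {n : ℕ} {k : ℝ} (hk : 0 < k)
    {x : EuclideanSpace ℝ (Fin n)} (hx : 1 - ‖x‖ ^ 2 ≠ 0) (V : EuclideanSpace ℝ (Fin n))
    (j l : Fin n) :
    metricInner (hypMetric k) x (leviCivita (hypMetric k) x V (hypFrame k j)) (hypFrame k l x)
      = 2 / (1 - ‖x‖ ^ 2) * (x j * V l - V j * x l) := by
  rw [metricInner_hypMetric k hx, leviCivita_hypFrame hk hx, hypFrame, real_inner_smul_right,
    inner_coordVec]
  simp
  field_simp

theorem spinConnection_hyp {n : ℕ} {k : ℝ} (hk : 0 < k) {x : EuclideanSpace ℝ (Fin n)}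
    (hx : 1 - ‖x‖ ^ 2 ≠ 0) (ψ : EuclideanSpace ℝ (Fin n) → Spinor n)
    (V : EuclideanSpace ℝ (Fin n)) :
    spinConnection (hypMetric k) (hypFrame k) ψ x V = fderiv ℝ ψ x V
      + ((1 / (1 - ‖x‖ ^ 2) : ℝ) : ℂ) •
        (cliff x (cliff V (ψ x)) + ((inner ℝ x V : ℝ) : ℂ) • ψ x) := by
  rw [spinConnection, cliff_cliff_eq_sum_lt, sub_add_cancel]
  simp only [metricInner_leviCivita_hypFrame hk hx, Complex.ofReal_mul, mul_smul,
    ← Finset.smul_sum]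
  rw [smul_smul]
  congr 2
  push_cast
  ring

theorem cliffordMul_hyp {n : ℕ} {k : ℝ} (hk : 0 < k) {x : EuclideanSpace ℝ (Fin n)}
    (hx : 1 - ‖x‖ ^ 2 ≠ 0) (V : EuclideanSpace ℝ (Fin n)) (s : Spinor n) :
    cliffordMul (hypMetric k) (hypFrame k) x V s =
      ((2 / k / (1 - ‖x‖ ^ 2) : ℝ) : ℂ) • cliff V s := by
  rw [cliffordMul, cliff, Finset.smul_sum]
  refine Finset.sum_congr rfl fun j _ => ?_
  rw [metricInner_hypMetric k hx, hypFrame, real_inner_smul_right, inner_coordVec, smul_smul,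
    ← Complex.ofReal_mul]
  congr 2
  field_simp

/-- The Killing equation in ball coordinates. -/
theorem isKillingSpinor_iff {n : ℕ} {k : ℝ} (hk : 0 < k) (φ : Minkowski n → Spinor n) :
    IsKillingSpinor k φ ↔ ContDiffOn ℝ ∞ (fun x => φ (ofBall k x)) (Metric.ball 0 1) ∧
      ∀ x ∈ Metric.ball (0 : EuclideanSpace ℝ (Fin n)) 1, ∀ V : EuclideanSpace ℝ (Fin n),
        fderiv ℝ (fun y => φ (ofBall k y)) x V = -(((1 / (1 - ‖x‖ ^ 2) : ℝ) : ℂ) •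
          (cliff x (cliff V (φ (ofBall k x))) + ((inner ℝ x V : ℝ) : ℂ) • φ (ofBall k x)
            + Complex.I • cliff V (φ (ofBall k x)))) := by
  refine and_congr_right fun _ => forall₂_congr fun x hx => forall_congr' fun V => ?_
  have hx' := (one_sub_norm_sq_pos hx).ne'
  rw [spinConnection_hyp hk hx', cliffordMul_hyp hk hx', smul_smul]
  have : Complex.I / 2 * (k : ℂ) * ((2 / k / (1 - ‖x‖ ^ 2) : ℝ) : ℂ)
      = ((1 / (1 - ‖x‖ ^ 2) : ℝ) : ℂ) * Complex.I := by
    have hk' : (k : ℂ) ≠ 0 := by exact_mod_cast hk.ne'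
    have hx'' : (1 - (‖x‖ : ℂ) ^ 2) ≠ 0 := by exact_mod_cast hx'
    push_cast
    field_simp
  rw [this, mul_smul, add_assoc, ← smul_add, eq_neg_iff_add_eq_zero]

/-! ### Killing spinors -/

theorem hasFDerivAt_sqrt_two_div {E : Type*} [NormedAddCommGroup E] [InnerProductSpace ℝ E]
    {x : E} (hx : 0 < 1 - ‖x‖ ^ 2) :
    HasFDerivAt (fun y : E => √(2 / (1 - ‖y‖ ^ 2)))
      ((√(2 / (1 - ‖x‖ ^ 2)) / (1 - ‖x‖ ^ 2)) • innerSL ℝ x) x := by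
  have hpos : 0 < 2 / (1 - ‖x‖ ^ 2) := by positivity
  refine ((hasFDerivAt_const_div_one_sub_norm_sq 2 hx.ne').sqrt hpos.ne').congr_fderiv ?_
  have hs := Real.sqrt_pos.mpr hpos
  have hs2 := Real.sq_sqrt hpos.le
  rw [smul_smul]
  congr 1
  generalize √(2 / (1 - ‖x‖ ^ 2)) = s at *
  rw [eq_div_iff hx.ne'] at hs2
  field_simp
  linarith

/-- The derivative of `√(2 / (1 - |x|²)) (ψ + z c(x) ψ)`. -/
theorem exists_hasFDerivAt_sqrt_smul_add_cliff {n : ℕ} {x : EuclideanSpace ℝ (Fin n)}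
    (hx : 0 < 1 - ‖x‖ ^ 2) (z : ℂ) {ψ : EuclideanSpace ℝ (Fin n) → Spinor n}
    (hψ : DifferentiableAt ℝ ψ x) :
    ∃ L : EuclideanSpace ℝ (Fin n) →L[ℝ] Spinor n,
      HasFDerivAt (fun y => ((√(2 / (1 - ‖y‖ ^ 2)) : ℝ) : ℂ) • (ψ y + z • cliff y (ψ y))) L x ∧
      ∀ V, L V = ((√(2 / (1 - ‖x‖ ^ 2)) : ℝ) : ℂ) •
        (((1 / (1 - ‖x‖ ^ 2) : ℝ) : ℂ) • ((inner ℝ x V : ℝ) : ℂ) • (ψ x + z • cliff x (ψ x))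
          + fderiv ℝ ψ x V + z • (cliff V (ψ x) + cliff x (fderiv ℝ ψ x V))) := by
  -- Real scalars replace the coerced complex ones, so that the product rules over `ℝ` apply to
  -- `cliffL`.
  simp only [Complex.coe_smul, ← cliffL_apply]
  have h1 := (cliffL n).hasFDerivAt_of_bilinear (hasFDerivAt_id x) hψ.hasFDerivAt
  have h2 := (hasFDerivAt_sqrt_two_div hx).fun_smul
    (hψ.hasFDerivAt.fun_add (h1.fun_const_smul z))
  refine ⟨_, h2, fun V => ?_⟩
  simp
  module

theorem killingSpinor_ofBall {n : ℕ} {k : ℝ} (hk : 0 < k) (a : Spinor n)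
    {x : EuclideanSpace ℝ (Fin n)} (hx : x ∈ Metric.ball (0 : EuclideanSpace ℝ (Fin n)) 1) :
    killingSpinor k a (ofBall k x) =
      ((√(2 / (1 - ‖x‖ ^ 2)) : ℝ) : ℂ) • (a + (-Complex.I) • cliff x a) := by
  rw [killingSpinor, toBall_ofBall hk hx, neg_smul, ← sub_eq_add_neg]

theorem contDiffOn_sqrt_two_div (E : Type*) [NormedAddCommGroup E] [InnerProductSpace ℝ E] :
    ContDiffOn ℝ ∞ (fun y : E => √(2 / (1 - ‖y‖ ^ 2))) (Metric.ball 0 1) := by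
  refine ContDiffOn.sqrt ?_ fun x hx => ?_
  · refine ContDiffOn.div contDiffOn_const ?_ fun x hx => (one_sub_norm_sq_pos hx).ne'
    exact (contDiff_const.sub (contDiff_norm_sq ℝ)).contDiffOn
  · have := one_sub_norm_sq_pos hx
    positivity

theorem isKillingSpinor_killingSpinor {n : ℕ} {k : ℝ} (hk : 0 < k) (a : Spinor n) :
    IsKillingSpinor k (killingSpinor k a) := by
  rw [isKillingSpinor_iff hk]
  constructor
  · refine ContDiffOn.congr ?_ fun x hx => killingSpinor_ofBall hk a hx
    simp only [Complex.coe_smul, ← cliffL_apply]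
    refine (contDiffOn_sqrt_two_div _).smul (contDiffOn_const.add (ContDiffOn.const_smul _ ?_))
    exact ((cliffL n).flip a).contDiff.contDiffOn
  · intro x hx V
    have hx' := one_sub_norm_sq_pos hx
    obtain ⟨L, hL, hLV⟩ := exists_hasFDerivAt_sqrt_smul_add_cliff hx' (-Complex.I)
      (differentiableAt_const (𝕜 := ℝ) (x := x) a)
    have e : (fun y => killingSpinor k a (ofBall k y)) =ᶠ[nhds x] fun y =>
        ((√(2 / (1 - ‖y‖ ^ 2)) : ℝ) : ℂ) • (a + (-Complex.I) • cliff y a) := by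
      filter_upwards [Metric.isOpen_ball.mem_nhds hx] with y hy
      exact killingSpinor_ofBall hk a hy
    rw [(hL.congr_of_eventuallyEq e).fderiv, hLV, killingSpinor_ofBall hk a hx]
    have h0 : cliff x (0 : Spinor n) = 0 := by rw [← cliffL_apply, map_zero]
    simp only [fderiv_const_apply, zero_apply, h0, cliff_add_right, cliff_smul_right]
    -- Moving `c(x)` to the left leaves only combinations of `a`, `c(x) a`, `c(V) a` and `c(x) c(V)
    -- a`, whose coefficients can be compared.
    rw [cliff_cliff_comm V x a]
    simp only [cliff_sub_right, cliff_neg_right, cliff_smul_right, cliff_cliff_self,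
      real_inner_comm x V]
    have hc : (1 - (‖x‖ : ℂ) ^ 2) ≠ 0 := by exact_mod_cast hx'.ne'
    push_cast
    match_scalars <;> field_simp <;> ring_nf <;> simp <;> ring

/-- Multiplication by the inverse of `√(2 / (1 - |x|²)) (1 - √-1 c(x))` turns a Killing spinor into
a constant. -/
theorem IsKillingSpinor.exists_const {n : ℕ} {k : ℝ} (hk : 0 < k) {ψ : Minkowski n → Spinor n}
    (hψ : IsKillingSpinor k ψ) : ∃ b : Spinor n,
      ∀ x ∈ Metric.ball (0 : EuclideanSpace ℝ (Fin n)) 1, ((√(2 / (1 - ‖x‖ ^ 2)) : ℝ) : ℂ) •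
        (ψ (ofBall k x) + Complex.I • cliff x (ψ (ofBall k x))) = b := by
  obtain ⟨hs, hD⟩ := (isKillingSpinor_iff hk ψ).mp hψ
  have key : ∀ x ∈ Metric.ball (0 : EuclideanSpace ℝ (Fin n)) 1,
      HasFDerivAt (fun y => ((√(2 / (1 - ‖y‖ ^ 2)) : ℝ) : ℂ) •
        (ψ (ofBall k y) + Complex.I • cliff y (ψ (ofBall k y))))
        (0 : EuclideanSpace ℝ (Fin n) →L[ℝ] Spinor n) x := by
    intro x hx
    have hx' := one_sub_norm_sq_pos hx
    have hd : DifferentiableAt ℝ (fun y => ψ (ofBall k y)) x :=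
      (hs.contDiffAt (Metric.isOpen_ball.mem_nhds hx)).differentiableAt (by simp)
    obtain ⟨L, hL, hLV⟩ := exists_hasFDerivAt_sqrt_smul_add_cliff hx' Complex.I hd
    refine hL.congr_fderiv (ContinuousLinearMap.ext fun V => ?_)
    rw [hLV, hD x hx V, zero_apply]
    -- With the Killing equation substituted for the derivative, the claim is an algebraic identity
    -- in the value of `ψ` at `x`; it needs only `c(x)² = -|x|²`.
    generalize ψ (ofBall k x) = s
    simp only [cliff_add_right, cliff_smul_right, cliff_neg_right, cliff_cliff_self]
    have hc : (1 - (‖x‖ : ℂ) ^ 2) ≠ 0 := by exact_mod_cast hx'.ne'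
    push_cast
    match_scalars <;> field_simp <;> ring_nf <;> simp
  have h0 : (0 : EuclideanSpace ℝ (Fin n)) ∈ Metric.ball (0 : EuclideanSpace ℝ (Fin n)) 1 := by
    simp
  refine ⟨_, fun x hx => Metric.isOpen_ball.is_const_of_fderiv_eq_zero
    (convex_ball _ _).isPreconnected
    (fun y hy => (key y hy).differentiableAt.differentiableWithinAt)
    (fun y hy => (key y hy).fderiv) hx h0⟩

theorem IsKillingSpinor.exists_eqOn {n : ℕ} {k : ℝ} (hk : 0 < k) {ψ : Minkowski n → Spinor n}
    (hψ : IsKillingSpinor k ψ) :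
    ∃ b : Spinor n, Set.EqOn ψ (killingSpinor k b) (hyperboloid n k) := by
  obtain ⟨b, hb⟩ := hψ.exists_const hk
  -- The factor `1 / 2` is forced by `f² (1 - √-1 c(x)) (1 + √-1 c(x)) = f² (1 - |x|²) = 2`.
  refine ⟨(1 / 2 : ℂ) • b, fun P hP => ?_⟩
  have hx := toBall_mem_ball hk hP
  have hP' := ofBall_toBall hk hP
  rw [← hP', killingSpinor_ofBall hk _ hx, ← hb _ hx]
  generalize toBall k P = x at *
  have hx' := one_sub_norm_sq_pos hx
  have hs : ((√(2 / (1 - ‖x‖ ^ 2)) : ℝ) : ℂ) ^ 2 = 2 / (1 - (‖x‖ : ℂ) ^ 2) := by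
    rw [← Complex.ofReal_pow, Real.sq_sqrt (by positivity)]
    push_cast; rfl
  generalize ((√(2 / (1 - ‖x‖ ^ 2)) : ℝ) : ℂ) = f at *
  have hc : (1 - (‖x‖ : ℂ) ^ 2) ≠ 0 := by exact_mod_cast hx'.ne'
  rw [eq_div_iff hc] at hs
  simp only [cliff_add_right, cliff_smul_right, cliff_cliff_self]
  push_cast
  match_scalars
  · linear_combination (-1 / 2 : ℂ) * hs - (f ^ 2 * (‖x‖ : ℂ) ^ 2 / 2) * Complex.I_sq
  · ring

theorem killingSpinor_ofBall_zero {n : ℕ} {k : ℝ} (hk : 0 < k) (b : Spinor n) :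
    killingSpinor k b (ofBall k 0) = ((√2 : ℝ) : ℂ) • b := by
  rw [killingSpinor_ofBall hk b (by simp), ← cliffL_apply]
  simp

/-! ### The length of a Killing spinor. -/

theorem norm_cliff_sq {n : ℕ} (x : EuclideanSpace ℝ (Fin n)) (a : Spinor n) :
    ‖cliff x a‖ ^ 2 = ‖x‖ ^ 2 * ‖a‖ ^ 2 := by
  have h : ((‖cliff x a‖ ^ 2 : ℝ) : ℂ) = ((‖x‖ ^ 2 * ‖a‖ ^ 2 : ℝ) : ℂ) := by
    have h1 := inner_self_eq_norm_sq_to_K (𝕜 := ℂ) (cliff x a)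
    rw [inner_cliff_left, cliff_cliff_self, inner_neg_right, inner_smul_right, neg_neg,
      inner_self_eq_norm_sq_to_K] at h1
    push_cast at h1 ⊢
    exact h1.symm
  exact_mod_cast h

theorem inner_zeta_fst {n : ℕ} (x : EuclideanSpace ℝ (Fin n)) (a : Spinor n) :
    inner ℝ x (zeta a).1 = (inner ℂ a (Complex.I • cliff x a)).re := by
  rw [inner_eq_sum, cliff, Finset.smul_sum, inner_sum, Complex.re_sum]
  refine Finset.sum_congr rfl fun j _ => ?_
  rw [smul_comm, inner_smul_right, Complex.re_ofReal_mul]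
  rfl

theorem zeta_snd_eq {n : ℕ} (a : Spinor n) : (zeta a).2 = ‖a‖ ^ 2 := by
  simp only [zeta]
  rw [smul_smul, Complex.I_mul_I, neg_one_smul, inner_neg_right, inner_self_eq_norm_sq_to_K]
  simp [← Complex.ofReal_pow]

theorem norm_killingSpinor_sq {n : ℕ} {k : ℝ} (hk : 0 < k) (a : Spinor n) {P : Minkowski n}
    (hP : P ∈ hyperboloid n k) :
    ‖killingSpinor k a P‖ ^ 2 = -2 * k * lorentz P (zeta a) := by
  have hx := toBall_mem_ball hk hP
  have hP' := ofBall_toBall hk hP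
  rw [← hP', killingSpinor_ofBall hk _ hx]
  generalize toBall k P = x at *
  have hx' := one_sub_norm_sq_pos hx
  rw [norm_smul, mul_pow, Complex.norm_real, Real.norm_eq_abs, sq_abs,
    Real.sq_sqrt (by positivity), norm_add_sq (𝕜 := ℂ), norm_smul, norm_neg, Complex.norm_I,
    one_mul, norm_cliff_sq, neg_smul, inner_neg_right, map_neg, lorentz_eq, zeta_snd_eq]
  simp only [ofBall, real_inner_smul_left, inner_zeta_fst]
  simp only [RCLike.re_to_complex]
  field_simp
  ring

end HyperbolicSpinor

end

theorem proposition3p3 (n : ℕ) (k : ℝ) (hk : 0 < k) (a : HyperbolicSpinor.Spinor n) :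
    HyperbolicSpinor.IsKillingSpinor k (HyperbolicSpinor.killingSpinor k a) ∧
    (∀ ψ : HyperbolicSpinor.Minkowski n → HyperbolicSpinor.Spinor n, HyperbolicSpinor.IsKillingSpinor k ψ →
      ∃! b : HyperbolicSpinor.Spinor n, Set.EqOn ψ (HyperbolicSpinor.killingSpinor k b) (HyperbolicSpinor.hyperboloid n k)) ∧
    ∀ X ∈ HyperbolicSpinor.hyperboloid n k, ‖HyperbolicSpinor.killingSpinor k a X‖ ^ 2 = -2 * k * HyperbolicSpinor.lorentz X (HyperbolicSpinor.zeta a) := by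
  refine ⟨HyperbolicSpinor.isKillingSpinor_killingSpinor hk a, fun ψ hψ => ?_,
    fun X hX => HyperbolicSpinor.norm_killingSpinor_sq hk a hX⟩
  obtain ⟨b, hb⟩ := hψ.exists_eqOn hk
  refine ⟨b, hb, fun b' hb' => ?_⟩
  -- At the centre of the ball the spinor field of `b` equals `√2 b`, so it determines `b`.
  have h0 := HyperbolicSpinor.ofBall_zero_mem_hyperboloid (n := n) hk
  have h := (hb' h0).symm.trans (hb h0)
  rw [HyperbolicSpinor.killingSpinor_ofBall_zero hk,
    HyperbolicSpinor.killingSpinor_ofBall_zero hk] at h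
  exact smul_right_injective _ (by simp) h
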